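/- **Setting.** Let $d, T \ge 1$ be integers and $D, B > 0$. For a nonempty closed convex set $\mathcal X \subseteq \mathbb R^d$, let $\mathcal O_{c,2}(\mathcal X)$ be the set of all pairs $(f,O)$ of a convex function $f\colon \mathcal X \to \mathbb R$ and a stochastic first-order oracle $O$ which, at a query point $x \in \mathcal X$, returns (with fresh randomness) a random vector $\hat g(x)$ such that $\mathbb E[\hat g(x)] \in \partial f(x)$ and $\|\hat g(x)\|_2^2 \le B^2$ almost surely. An *oblivious sampling channel* is given by a probability vector $(p_1,\dots,p_d)$; for an input $g \in \mathbb R^d$ it outputs $g(i)e_i$ with probability $p_i$, where $e_1,\dots,e_d$ is the standard basis. Let $\mathcal W_{\rm obl}$ be the set of these channels. In round $t = 1,\dots,T$ a first-order algorithm $\pi$ queries a point $x_t \in \mathcal X$, an adaptive channel selection strategy $S$ selects a channel $W_t \in \mathcal W_{\rm obl}$, and the algorithm observes only the output $Y_t$ of $W_t$ on the input $\hat g(x_t)$; both $x_t$ and $W_t$ may depend on $Y_1,\dots,Y_{t-1}$ (and on a random seed that is independent of the oracle's and the channels' randomness). After $T$ rounds, $\pi$ outputs a point $\hat x \in \mathcal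 X$ that depends on $Y_1,\dots,Y_T$ (and the seed). The adaptive minmax error is $$\mathcal E^*(\mathcal X, \mathcal O_{c,2}, T, \mathcal W_{\rm obl}) = \inf_{\pi}\,\inf_{S}\,\sup_{(f,O)\in\mathcal O_{c,2}(\mathcal X)} \mathbb E\Big[f(\hat x) - \min_{x\in\mathcal X} f(x)\Big].$$ **Theorem.** Suppose that $T \ge d/4$. 1. (Lower bound.) $$\sup_{\mathcal X}\ \mathcal E^*(\mathcal X, \mathcal O_{c,2}, T, \mathcal W_{\rm obl}) \ \ge\ \frac{1}{72}\cdot\frac{\sqrt d\, D B}{\sqrt T},$$ where the supremum is over all nonempty closed convex $\mathcal X \subseteq \mathbb R^d$ of $\ell_2$ diameter at most $D$. 2. (Uniform random coordinate descent matches it up to a constant factor.) For every such $\mathcal X$ and every $x_1 \in \mathcal X$, the algorithm that uses in each round the oblivious sampling channel with $p_i = 1/d$ for all $i$, takes $x_{t+1}$ to be the Euclidean projection of $x_t - \eta Y_t$ onto $\mathcal X$ with $\eta = D\sqrt d/(B\sqrt T)$, and outputs $\hat x = \frac1T\sum_{t=1}^T x_t$, satisfies $$\mathbb E\Big[f(\hat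 x) - \min_{x\in\mathcal X} f(x)\Big] \le \frac{\sqrt d\, D B}{\sqrt T}\qquad\text{for all } (f,O)\in\mathcal O_{c,2}(\mathcal X).$$ -/

import Mathlib

open MeasureTheory ProbabilityTheory
open scoped ENNReal

noncomputable section

namespace InfoConstrainedOpt

/-- `ℝ^d` with the Euclidean norm. -/
abbrev Vec (d : ℕ) : Type := EuclideanSpace ℝ (Fin d)

/-- The admissible domains: nonempty closed convex subsets of `ℝ^d` whose `ℓ₂` diameter is at
most `D`. -/
def domains (d : ℕ) (D : ℝ) : Set (Set (Vec d)) :=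
  {X | X.Nonempty ∧ IsClosed X ∧ Convex ℝ X ∧ ∀ x ∈ X, ∀ y ∈ X, ‖x - y‖ ≤ D}

/-- The subgradients at `x` of a function `f` with domain `X`. -/
def subdifferential {d : ℕ} (X : Set (Vec d)) (f : Vec d → ℝ) (x : Vec d) : Set (Vec d) :=
  {g | ∀ y ∈ X, f x + inner ℝ g (y - x) ≤ f y}

/-- The pairs of a convex function `f` on `X` (its values outside of `X` play no role) and a
stochastic first-order oracle `O`, where `O x` is the law of the subgradient estimate returned at
the query point `x`: the estimates are unbiased and almost surely bounded by `B` in `ℓ₂` norm.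
Each query is answered with fresh randomness. -/
def convexLipschitzClass {d : ℕ} (X : Set (Vec d)) (B : ℝ) :
    Set ((Vec d → ℝ) × Kernel (Vec d) (Vec d)) :=
  {fO | ConvexOn ℝ X fO.1 ∧ IsMarkovKernel fO.2 ∧
    ∀ x ∈ X, (∫ g, g ∂(fO.2 x)) ∈ subdifferential X fO.1 x ∧ ∀ᵐ g ∂(fO.2 x), ‖g‖ ^ 2 ≤ B ^ 2}

/-- The law of `g(I) e_I`, where the random coordinate `I` equals `i` with probability `p i`. -/
def obliviousLaw {d : ℕ} (p : Fin d → ℝ) (g : Vec d) : Measure (Vec d) :=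
  ∑ i, ENNReal.ofReal (p i) • Measure.dirac (EuclideanSpace.single i (g i))

theorem measurable_obliviousLaw {d : ℕ} (p : Fin d → ℝ) :
    Measurable (obliviousLaw p : Vec d → Measure (Vec d)) := by
  have hm : ∀ i : Fin d, Measurable fun g : Vec d => (EuclideanSpace.single i (g i) : Vec d) := by
    intro i
    have h : Continuous fun g : Vec d => (EuclideanSpace.single i (g i) : Vec d) := by
      refine (PiLp.continuous_toLp 2 _).comp (continuous_pi fun j => ?_)
      by_cases hj : j = i
      · subst hj
        simpa using (PiLp.continuous_apply 2 (fun _ : Fin d => ℝ) j)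
      · simpa [Pi.single_eq_of_ne hj] using continuous_const
    exact h.measurable
  refine Measure.measurable_of_measurable_coe _ fun s hs => ?_
  simp only [obliviousLaw, Measure.coe_finsetSum, Measure.coe_smul, Finset.sum_apply,
    Pi.smul_apply, smul_eq_mul]
  refine Finset.measurable_sum _ fun i _ => Measurable.const_mul ?_ _
  exact (Measure.measurable_coe hs).comp (Measure.measurable_dirac.comp (hm i))

/-- The channel `ℝ^d → ℝ^d` that reveals one coordinate of its input, sampled from `p`
independently of the input. -/
def obliviousChannel {d : ℕ} (p : Fin d → ℝ) : Kernel (Vec d) (Vec d) :=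
  ⟨obliviousLaw p, measurable_obliviousLaw p⟩

/-- The family of all oblivious sampling channels; `stdSimplex ℝ (Fin d)` is the set of
probability vectors. -/
def obliviousChannels (d : ℕ) : Set (Kernel (Vec d) (Vec d)) :=
  {W | ∃ p ∈ stdSimplex ℝ (Fin d), W = obliviousChannel p}

/-- A (possibly randomized) first-order optimization algorithm over the domain `X` with `T`
queries. The randomness is a seed `u`, uniform on `[0,1]`. With the queries numbered from `0`,
`query t u y` is the query point number `t` after the channel outputs `y 0, …, y (t - 1)`, and
`output u y` is the final point after all `T` channel outputs. -/
structure Algorithm {d : ℕ} (X : Set (Vec d)) (T : ℕ) where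
  query : ∀ t : ℕ, unitInterval → (Fin t → Vec d) → Vec d
  output : unitInterval → (Fin T → Vec d) → Vec d
  query_mem : ∀ t u y, query t u y ∈ X
  output_mem : ∀ u y, output u y ∈ X
  measurable_query : ∀ t, Measurable fun z : unitInterval × (Fin t → Vec d) => query t z.1 z.2
  measurable_output : Measurable fun z : unitInterval × (Fin T → Vec d) => output z.1 z.2

/-- An adaptive channel selection strategy for the channel family `𝒲`: the channel used for the
query number `t` is chosen from the previous channel outputs (and the seed `u`, which is shared
with the algorithm). -/
structure ChannelStrategy {d : ℕ} (𝒲 : Set (Kernel (Vec d) (Vec d))) where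
  select : ∀ t : ℕ, unitInterval → (Fin t → Vec d) → Kernel (Vec d) (Vec d)
  select_mem : ∀ t u y, select t u y ∈ 𝒲
  measurable_select : ∀ t, Measurable fun z : (unitInterval × (Fin t → Vec d)) × Vec d =>
    select t z.1.1 z.1.2 z.2

/-- The law of the first `t` channel outputs given the seed `u`: after the outputs `y`, the oracle
draws an estimate `g` at the current query point, the selected channel maps `g` to a new output
`y'`, and `y'` is appended to `y`. -/
def transcript {d T : ℕ} {X : Set (Vec d)} {𝒲 : Set (Kernel (Vec d) (Vec d))}
    (O : Kernel (Vec d) (Vec d)) (π : Algorithm X T) (S : ChannelStrategy 𝒲)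
    (u : unitInterval) : ∀ t : ℕ, Measure (Fin t → Vec d)
  | 0 => Measure.dirac Fin.elim0
  | t + 1 => (transcript O π S u t).bind fun y =>
      (O (π.query t u y)).bind fun g =>
        (S.select t u y g).map fun y' => (Fin.snoc y y' : Fin (t + 1) → Vec d)

/-- The expected optimality gap `E[f(x̂) - min_X f]` of the final point `x̂`. -/
def optError {d T : ℕ} {X : Set (Vec d)} {𝒲 : Set (Kernel (Vec d) (Vec d))}
    (f : Vec d → ℝ) (O : Kernel (Vec d) (Vec d)) (π : Algorithm X T) (S : ChannelStrategy 𝒲) :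
    ℝ≥0∞ :=
  ∫⁻ u : unitInterval, ∫⁻ y, ENNReal.ofReal (f (π.output u y) - ⨅ x : X, f x)
    ∂(transcript O π S u T)

/-- The adaptive minmax optimization error. -/
def minmaxError {d : ℕ} (X : Set (Vec d)) (𝒪 : Set ((Vec d → ℝ) × Kernel (Vec d) (Vec d)))
    (T : ℕ) (𝒲 : Set (Kernel (Vec d) (Vec d))) : ℝ≥0∞ :=
  ⨅ (π : Algorithm X T) (S : ChannelStrategy 𝒲), ⨆ fO ∈ 𝒪, optError fO.1 fO.2 π S

/-- `(π, S)` is (projected) random coordinate descent with uniform sampling, started at `x₁`, with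
constant step size `η`: each channel is the oblivious sampling channel with all probabilities equal
to `1 / d`, the next query point is the nearest point in `X` to `x - η Y`, where `x` is the current
query point and `Y` the channel output, and the final point is the average of the `T` query
points. -/
def IsUniformRCD {d T : ℕ} {X : Set (Vec d)} (x₁ : Vec d) (η : ℝ) (π : Algorithm X T)
    (S : ChannelStrategy (obliviousChannels d)) : Prop :=
  (∀ t u y, S.select t u y = obliviousChannel fun _ => 1 / (d : ℝ)) ∧
  (∀ u y, π.query 0 u y = x₁) ∧
  (∀ (t : ℕ) (u : unitInterval) (y : Fin t → Vec d) (y' : Vec d), ∀ z ∈ X,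
    ‖π.query t u y - η • y' - π.query (t + 1) u (Fin.snoc y y')‖ ≤
      ‖π.query t u y - η • y' - z‖) ∧
  ∀ (u : unitInterval) (y : Fin T → Vec d),
    π.output u y = (1 / (T : ℝ)) • ∑ t : Fin T, π.query t u fun i => y (Fin.castLE t.is_lt.le i)

end InfoConstrainedOpt

end

open InfoConstrainedOpt

namespace InfoConstrainedOpt

/-! Upper bound: a uniform coordinate sample `Y` of `g` has mean `g / d` and second moment `‖g‖² /
d`. Projection onto a convex set does not increase the distance to a minimizer `z`, so the potential
`(2η/d) · (accumulated gap) + ‖x_t - z‖²` grows in expectation by at most `η² B² / d` per round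
(`lintegral_uniform_step_le`, `IsUniformRCD.lintegral_cumGap_le`). Jensen's inequality turns the
accumulated gap into the gap of the average (`IsUniformRCD.optError_le`).

Lower bound: on a cube of half side `r`, take the linear functions with gradient `ε c v`, `v` a sign
vector, and the oracle returning `± c v` with bias `ε`. Through an oblivious channel, a round shows
only one coordinate `i` and a sign of bias `ε v i` (`lintegral_channel_signLaw`). For each `i`,
compare the transcript laws under `v` and under `v` with sign `i` flipped by their Hellinger
affinity. A round costs at most `ε²` times the probability of sampling `i`; these probabilities sum
to one, so the affinities summed over `i` and averaged over `v` lose only `ε²` per round, however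
adaptive the strategy (`sum_sum_sqrt_signWeight_ge`). While `ε² T ≤ d / 16`, no estimate correlates
well with `v` (`sum_correlation_le`), and on the cube the optimality gap is exactly a lack of
correlation (`gap_cube_ge`). Averaging over `v` and over the seed bounds the worst case. -/

theorem obliviousChannel_apply {d : ℕ} (p : Fin d → ℝ) (g : Vec d) :
    obliviousChannel p g = obliviousLaw p g := rfl

theorem lintegral_obliviousChannel {d : ℕ} (p : Fin d → ℝ) (g : Vec d) (F : Vec d → ℝ≥0∞)
    (hF : Measurable F) :
    ∫⁻ y, F y ∂(obliviousChannel p g) =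
      ∑ i, ENNReal.ofReal (p i) * F (EuclideanSpace.single i (g i)) := by
  rw [obliviousChannel_apply, obliviousLaw, lintegral_finsetSum_measure]
  refine Finset.sum_congr rfl fun i _ => ?_
  rw [lintegral_smul_measure, lintegral_dirac' _ hF, smul_eq_mul]

theorem isProbabilityMeasure_obliviousChannel {d : ℕ} {p : Fin d → ℝ}
    (hp : p ∈ stdSimplex ℝ (Fin d)) (g : Vec d) :
    IsProbabilityMeasure (obliviousChannel p g) := by
  constructor
  rw [← lintegral_one, lintegral_obliviousChannel p g _ measurable_const]
  simp only [mul_one]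
  rw [← ENNReal.ofReal_sum_of_nonneg fun i _ => hp.1 i, hp.2, ENNReal.ofReal_one]

theorem measurable_snoc {d t : ℕ} :
    Measurable fun z : (Fin t → Vec d) × Vec d => (Fin.snoc z.1 z.2 : Fin (t + 1) → Vec d) := by
  refine measurable_pi_lambda _ fun j => ?_
  refine Fin.lastCases ?_ (fun i => ?_) j
  · simpa using measurable_snd
  · simpa [Function.comp_def] using
      (measurable_pi_apply (X := fun _ : Fin t => Vec d) i).comp (measurable_fst (β := Vec d))

/-! ### Integration against the transcript law -/

section Transcript

variable {d T : ℕ} {X : Set (Vec d)} {𝒲 : Set (Kernel (Vec d) (Vec d))}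
  (O : Kernel (Vec d) (Vec d)) (π : Algorithm X T) (S : ChannelStrategy 𝒲) (u : unitInterval)

/-- The channel used in round `t` as a kernel from (past outputs, oracle estimate). -/
noncomputable def ChannelStrategy.selectKernel (t : ℕ) :
    Kernel ((Fin t → Vec d) × Vec d) (Vec d) where
  toFun z := S.select t u z.1 z.2
  measurable' := (S.measurable_select t).comp
    ((measurable_const.prodMk measurable_fst).prodMk measurable_snd)

/-- The oracle's answer in round `t` as a kernel from the past outputs. -/
noncomputable def Algorithm.oracleKernel (t : ℕ) : Kernel (Fin t → Vec d) (Vec d) :=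
  O.comap (fun y => π.query t u y)
    ((π.measurable_query t).comp (measurable_const.prodMk measurable_id))

theorem measurable_lintegral_round [IsMarkovKernel O]
    (hS : ∀ t u y g, IsProbabilityMeasure (S.select t u y g)) (t : ℕ)
    {F : (Fin (t + 1) → Vec d) → ℝ≥0∞} (hF : Measurable F) :
    Measurable fun y : Fin t → Vec d =>
      ∫⁻ g, ∫⁻ y', F (Fin.snoc y y') ∂(S.select t u y g) ∂(O (π.query t u y)) := by
  have : IsMarkovKernel (S.selectKernel u t) := ⟨fun z => hS t u z.1 z.2⟩
  have : IsMarkovKernel (π.oracleKernel O u t) := by unfold Algorithm.oracleKernel; infer_instance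
  have h1 : Measurable fun z : (Fin t → Vec d) × Vec d =>
      ∫⁻ y', F (Fin.snoc z.1 y') ∂(S.selectKernel u t z) := by
    refine Measurable.lintegral_kernel_prod_right (κ := S.selectKernel u t)
      (f := fun (z : (Fin t → Vec d) × Vec d) y' => F (Fin.snoc z.1 y')) ?_
    exact hF.comp (measurable_snoc.comp
      ((measurable_fst.comp measurable_fst).prodMk measurable_snd))
  exact Measurable.lintegral_kernel_prod_right (κ := π.oracleKernel O u t)
      (f := fun y g => ∫⁻ y', F (Fin.snoc y y') ∂(S.selectKernel u t (y, g))) h1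

/-- The tower property of the interaction. Both bounds are inductions on the number of rounds
through this identity. -/
theorem lintegral_transcript_succ [IsMarkovKernel O]
    (hS : ∀ t u y g, IsProbabilityMeasure (S.select t u y g)) (t : ℕ)
    {F : (Fin (t + 1) → Vec d) → ℝ≥0∞} (hF : Measurable F) :
    ∫⁻ z, F z ∂(transcript O π S u (t + 1)) =
      ∫⁻ y, ∫⁻ g, ∫⁻ y', F (Fin.snoc y y') ∂(S.select t u y g) ∂(O (π.query t u y))
        ∂(transcript O π S u t) := by
  have hmap : ∀ (y : Fin t → Vec d) (μ : Measure (Vec d)) {G : (Fin (t + 1) → Vec d) → ℝ≥0∞},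
      Measurable G → ∫⁻ z, G z ∂(μ.map fun y' => (Fin.snoc y y' : Fin (t + 1) → Vec d)) =
        ∫⁻ y', G (Fin.snoc y y') ∂μ := fun y μ G hG =>
    lintegral_map hG (measurable_snoc.comp (measurable_const.prodMk measurable_id))
  have hin : ∀ y : Fin t → Vec d, Measurable fun g =>
      (S.select t u y g).map fun y' => (Fin.snoc y y' : Fin (t + 1) → Vec d) := fun y =>
    (Measure.measurable_map _ (measurable_snoc.comp (measurable_const.prodMk measurable_id))).comp
      (S.select t u y).measurable
  have hbind : ∀ (y : Fin t → Vec d) {G : (Fin (t + 1) → Vec d) → ℝ≥0∞}, Measurable G →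
      ∫⁻ z, G z ∂((O (π.query t u y)).bind fun g =>
        (S.select t u y g).map fun y' => (Fin.snoc y y' : Fin (t + 1) → Vec d)) =
      ∫⁻ g, ∫⁻ y', G (Fin.snoc y y') ∂(S.select t u y g) ∂(O (π.query t u y)) := by
    intro y G hG
    rw [Measure.lintegral_bind (hin y).aemeasurable hG.aemeasurable]
    exact lintegral_congr fun g => hmap y _ hG
  -- The outer `bind` integrates as expected only if the one-round law is measurable in the past;
  -- testing it on indicators reduces this to `measurable_lintegral_round`.
  have hout : Measurable fun y : Fin t → Vec d => (O (π.query t u y)).bind fun g =>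
        (S.select t u y g).map fun y' => (Fin.snoc y y' : Fin (t + 1) → Vec d) := by
    refine Measure.measurable_of_measurable_coe _ fun s hs => ?_
    have hG : Measurable (s.indicator (1 : (Fin (t + 1) → Vec d) → ℝ≥0∞)) :=
      measurable_one.indicator hs
    have h := measurable_lintegral_round O π S u hS t hG
    simp_rw [← hbind _ hG, lintegral_indicator_one hs] at h
    exact h
  rw [transcript, Measure.lintegral_bind hout.aemeasurable hF.aemeasurable]
  exact lintegral_congr fun y => hbind y hF

theorem lintegral_transcript_zero {F : (Fin 0 → Vec d) → ℝ≥0∞} (hF : Measurable F) :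
    ∫⁻ z, F z ∂(transcript O π S u 0) = F Fin.elim0 := by
  rw [transcript, lintegral_dirac' _ hF]

end Transcript

/-! ### Nearest points in convex sets -/

section Projection

variable {E : Type*} [NormedAddCommGroup E] [InnerProductSpace ℝ E]

theorem inner_sub_nearest_nonpos {X : Set E} (hX : Convex ℝ X) {a q : E} (hq : q ∈ X)
    (hmin : ∀ z ∈ X, ‖a - q‖ ≤ ‖a - z‖) {z : E} (hz : z ∈ X) :
    inner ℝ (a - q) (z - q) ≤ 0 := by
  refine (norm_eq_iInf_iff_real_inner_le_zero hX hq).1 ?_ z hz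
  have : Nonempty X := ⟨⟨q, hq⟩⟩
  refine le_antisymm (le_ciInf fun w => hmin w w.2) ?_
  exact ciInf_le ⟨0, by rintro _ ⟨w, rfl⟩; exact norm_nonneg _⟩ (⟨q, hq⟩ : X)

/-- The angle at `q` between `a` and `z` is not acute. Stated for a nearest point rather than for a
projection map because `IsUniformRCD` prescribes the queries by minimality. -/
theorem norm_nearest_sub_sq_le {X : Set E} (hX : Convex ℝ X) {a q : E} (hq : q ∈ X)
    (hmin : ∀ z ∈ X, ‖a - q‖ ≤ ‖a - z‖) {z : E} (hz : z ∈ X) :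
    ‖q - z‖ ^ 2 ≤ ‖a - z‖ ^ 2 := by
  have h := inner_sub_nearest_nonpos hX hq hmin hz
  have e : a - z = (a - q) - (z - q) := by abel
  rw [e, norm_sub_sq_real (a - q), norm_sub_rev q z]
  nlinarith [sq_nonneg ‖a - q‖]

/-- Adding the variational inequalities at `a` and `b` gives firm nonexpansiveness. The Lipschitz
property serves to make the iterates measurable. -/
theorem exists_nearest_point_map [CompleteSpace E] {X : Set E} (hne : X.Nonempty)
    (hcl : IsClosed X) (hX : Convex ℝ X) :
    ∃ P : E → E, (∀ a, P a ∈ X) ∧ (∀ a, ∀ z ∈ X, ‖a - P a‖ ≤ ‖a - z‖) ∧ LipschitzWith 1 P := by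
  have hex : ∀ a, ∃ q ∈ X, ∀ z ∈ X, ‖a - q‖ ≤ ‖a - z‖ := by
    intro a
    obtain ⟨q, hq, h⟩ := exists_norm_eq_iInf_of_complete_convex hne hcl.isComplete hX a
    refine ⟨q, hq, fun z hz => h ▸ ?_⟩
    exact ciInf_le ⟨0, by rintro _ ⟨w, rfl⟩; exact norm_nonneg _⟩ (⟨z, hz⟩ : X)
  choose P hP hmin using hex
  refine ⟨P, hP, hmin, LipschitzWith.of_dist_le_mul fun a b => ?_⟩
  rw [NNReal.coe_one, one_mul, dist_eq_norm, dist_eq_norm]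
  have h1 := inner_sub_nearest_nonpos hX (hP a) (hmin a) (hP b)
  have h2 := inner_sub_nearest_nonpos hX (hP b) (hmin b) (hP a)
  have h3 : ‖P a - P b‖ ^ 2 ≤ inner ℝ (a - b) (P a - P b) := by
    rw [← real_inner_self_eq_norm_sq]
    simp only [inner_sub_left, inner_sub_right] at h1 h2 ⊢
    linarith
  have h4 := real_inner_le_norm (a - b) (P a - P b)
  by_contra! h
  nlinarith [norm_nonneg (a - b), norm_nonneg (P a - P b)]

end Projection

/-! ### Regularity of the objective and the one-step descent inequality -/

section Convex

variable {d : ℕ} {X : Set (Vec d)} {B : ℝ} {f : Vec d → ℝ} {O : Kernel (Vec d) (Vec d)}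

theorem ae_norm_le_of_mem_class (hB : 0 ≤ B) (h : (f, O) ∈ convexLipschitzClass X B) {x : Vec d}
    (hx : x ∈ X) : ∀ᵐ g ∂(O x), ‖g‖ ≤ B := by
  filter_upwards [(h.2.2 x hx).2] with g hg
  exact (sq_le_sq₀ (norm_nonneg _) hB).1 hg

/-- The mean of the oracle is a subgradient of norm at most `B` at every point of `X`, boundary
included. This yields the continuity needed for a minimizer and for measurability. -/
theorem lipschitzOn_of_mem_class (hB : 0 ≤ B) (h : (f, O) ∈ convexLipschitzClass X B) :
    LipschitzOnWith B.toNNReal f X := by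
  have key : ∀ x ∈ X, ∀ y ∈ X, f x - f y ≤ B * ‖x - y‖ := by
    intro x hx y hy
    have hM : IsMarkovKernel O := h.2.1
    have hs := (h.2.2 x hx).1 y hy
    have hn : ‖∫ g, g ∂(O x)‖ ≤ B := by
      simpa using norm_integral_le_of_norm_le_const (ae_norm_le_of_mem_class hB h hx)
    have hi := (abs_le.1 (abs_real_inner_le_norm (∫ g, g ∂(O x)) (y - x))).1
    have := mul_le_mul_of_nonneg_right hn (norm_nonneg (y - x))
    rw [norm_sub_rev x y]
    simp only at hs
    linarith
  refine LipschitzOnWith.of_dist_le_mul fun x hx y hy => ?_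
  rw [Real.coe_toNNReal B hB, Real.dist_eq, dist_eq_norm, abs_sub_le_iff]
  exact ⟨key x hx y hy, norm_sub_rev x y ▸ key y hy x hx⟩

theorem isCompact_of_mem_domains {D : ℝ} (hX : X ∈ domains d D) : IsCompact X := by
  refine Metric.isCompact_of_isClosed_isBounded hX.2.1 ?_
  refine Metric.isBounded_iff.2 ⟨D, fun x hx y hy => ?_⟩
  rw [dist_eq_norm]
  exact hX.2.2.2 x hx y hy

/-- One step of uniform random coordinate descent decreases the expected squared distance to `z`,
up to the second-moment term. -/
theorem lintegral_uniform_step_le (hd : 0 < d) (hB : 0 ≤ B) {η : ℝ} (hη : 0 ≤ η)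
    (h : (f, O) ∈ convexLipschitzClass X B) {x z : Vec d} (hx : x ∈ X) (hz : z ∈ X) (r : ℝ)
    (hr : 0 ≤ r) {F : Vec d → ℝ≥0∞} (hF : Measurable F)
    (hFle : ∀ y', F y' ≤ ENNReal.ofReal (r + ‖x - η • y' - z‖ ^ 2)) :
    ∫⁻ g, ∫⁻ y', F y' ∂(obliviousChannel (fun _ : Fin d => 1 / (d : ℝ)) g) ∂(O x) ≤
      ENNReal.ofReal (r + ‖x - z‖ ^ 2 - 2 * η / d * (f x - f z) + η ^ 2 * B ^ 2 / d) := by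
  have hM : IsMarkovKernel O := h.2.1
  have hd' : (0 : ℝ) < d := Nat.cast_pos.2 hd
  have hsingle : ∀ (i : Fin d) (g : Vec d), ‖x - η • (EuclideanSpace.single i (g i) : Vec d) - z‖ ^ 2
      = ‖x - z‖ ^ 2 - 2 * η * (g i * (x - z) i) + η ^ 2 * g i ^ 2 := by
    intro i g
    have e : x - η • (EuclideanSpace.single i (g i) : Vec d) - z
      = (x - z) - η • (EuclideanSpace.single i (g i) : Vec d) := by abel
    rw [e, norm_sub_sq_real, inner_smul_right, EuclideanSpace.inner_single_right, norm_smul,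
      PiLp.norm_single, mul_pow, Real.norm_eq_abs, Real.norm_eq_abs, sq_abs, sq_abs]
    simp
    ring
  have hstep : ∀ g : Vec d, ∫⁻ y', F y' ∂(obliviousChannel (fun _ : Fin d => 1 / (d : ℝ)) g) ≤
      ENNReal.ofReal (r + ‖x - z‖ ^ 2 - 2 * η / d * inner ℝ (x - z) g + η ^ 2 / d * ‖g‖ ^ 2) := by
    intro g
    rw [lintegral_obliviousChannel _ _ _ hF]
    -- Averaging over the coordinates rebuilds the inner product and the squared norm, each with a
    -- factor `1 / d`.
    have : r + ‖x - z‖ ^ 2 - 2 * η / d * inner ℝ (x - z) g + η ^ 2 / d * ‖g‖ ^ 2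
      = ∑ i : Fin d, 1 / (d : ℝ) *
        (r + ‖x - η • (EuclideanSpace.single i (g i) : Vec d) - z‖ ^ 2) := by
      simp_rw [hsingle]
      rw [EuclideanSpace.real_norm_sq_eq g, PiLp.inner_apply, ← Finset.mul_sum]
      simp only [Finset.sum_add_distrib, Finset.sum_sub_distrib, ← Finset.mul_sum,
        Finset.sum_const, Finset.card_univ, Fintype.card_fin, nsmul_eq_mul]
      simp
      field_simp
      ring
    rw [this, ENNReal.ofReal_sum_of_nonneg fun i _ => by positivity]
    refine Finset.sum_le_sum fun i _ => ?_
    rw [ENNReal.ofReal_mul (by positivity)]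
    gcongr
    exact hFle _
  -- Passing from the lower integral of `ofReal` to a Bochner integral needs nonnegativity: complete
  -- the square and use Cauchy–Schwarz.
  have hnonneg : ∀ g : Vec d, 0 ≤
      r + ‖x - z‖ ^ 2 - 2 * η / d * inner ℝ (x - z) g + η ^ 2 / d * ‖g‖ ^ 2 := by
    intro g
    have h1 := real_inner_le_norm (x - z) g
    have hd1 : (1 : ℝ) ≤ d := by exact_mod_cast hd
    have h2 : (0 : ℝ) ≤ 1 / d * ((‖x - z‖ - η * ‖g‖) ^ 2 + 2 * η * (‖x - z‖ * ‖g‖ - inner ℝ (x - z) g)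
        + (d - 1) * ‖x - z‖ ^ 2) := by
      have := sub_nonneg.2 h1
      have := sub_nonneg.2 hd1
      positivity
    have h3 : 1 / d * ((‖x - z‖ - η * ‖g‖) ^ 2 + 2 * η * (‖x - z‖ * ‖g‖ - inner ℝ (x - z) g)
        + (d - 1) * ‖x - z‖ ^ 2) =
        ‖x - z‖ ^ 2 - 2 * η / d * inner ℝ (x - z) g + η ^ 2 / d * ‖g‖ ^ 2 := by
      field_simp
      ring
    linarith
  have hbd := ae_norm_le_of_mem_class hB h hx
  have hint : Integrable (fun g : Vec d => g) (O x) :=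
    Integrable.of_bound measurable_id.aestronglyMeasurable B hbd
  have hint1 : Integrable (fun g : Vec d => inner ℝ (x - z) g) (O x) := hint.const_inner _
  have hint2 : Integrable (fun g : Vec d => ‖g‖ ^ 2) (O x) := by
    refine Integrable.of_bound (measurable_norm.pow_const 2).aestronglyMeasurable (B ^ 2) ?_
    filter_upwards [(h.2.2 x hx).2] with g hg
    simpa using hg
  have hintA : Integrable (fun g : Vec d => r + ‖x - z‖ ^ 2 - 2 * η / d * inner ℝ (x - z) g)
    (O x) := (integrable_const _).sub (hint1.const_mul _)
  have hintB : Integrable (fun g : Vec d => r + ‖x - z‖ ^ 2 - 2 * η / d * inner ℝ (x - z) g +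
    η ^ 2 / d * ‖g‖ ^ 2) (O x) := hintA.add (hint2.const_mul _)
  refine (lintegral_mono hstep).trans ?_
  rw [← ofReal_integral_eq_lintegral_ofReal hintB (Filter.Eventually.of_forall hnonneg)]
  refine ENNReal.ofReal_le_ofReal ?_
  rw [integral_add hintA (hint2.const_mul _), integral_sub (integrable_const _)
    (hint1.const_mul _), integral_const_mul, integral_const_mul, integral_inner hint]
  have hsq : ∫ g, ‖g‖ ^ 2 ∂(O x) ≤ B ^ 2 := by
    have := integral_mono_ae hint2 (integrable_const (B ^ 2)) (h.2.2 x hx).2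
    simpa using this
  have hsub : f x - f z ≤ inner ℝ (x - z) (∫ g, g ∂(O x)) := by
    have := (h.2.2 x hx).1 z hz
    simp only at this
    rw [real_inner_comm, ← neg_sub z x, inner_neg_right]
    linarith
  have h1 : 2 * η / d * (f x - f z) ≤ 2 * η / d * inner ℝ (x - z) (∫ g, g ∂(O x)) := by gcongr
  have h2 : η ^ 2 / d * ∫ g, ‖g‖ ^ 2 ∂(O x) ≤ η ^ 2 / d * B ^ 2 := by gcongr
  have h3 : η ^ 2 * B ^ 2 / d = η ^ 2 / d * B ^ 2 := by ring
  rw [h3]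
  simp only [integral_const, probReal_univ, smul_eq_mul, one_mul]
  linarith

end Convex

section Transcript

variable {d T : ℕ} {X : Set (Vec d)} {𝒲 : Set (Kernel (Vec d) (Vec d))}
  (O : Kernel (Vec d) (Vec d)) (π : Algorithm X T) (S : ChannelStrategy 𝒲) (u : unitInterval)

theorem isProbabilityMeasure_transcript [IsMarkovKernel O]
    (hS : ∀ t u y g, IsProbabilityMeasure (S.select t u y g)) (t : ℕ) :
    IsProbabilityMeasure (transcript O π S u t) := by
  induction t with
  | zero => rw [transcript]; infer_instance
  | succ t ih =>
    constructor
    rw [← lintegral_one, lintegral_transcript_succ O π S u hS t measurable_const]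
    simp

end Transcript

theorem isProbabilityMeasure_select {d : ℕ} (S : ChannelStrategy (obliviousChannels d)) (t : ℕ)
    (u : unitInterval) (y : Fin t → Vec d) (g : Vec d) :
    IsProbabilityMeasure (S.select t u y g) := by
  obtain ⟨p, hp, h⟩ := S.select_mem t u y
  rw [h]
  exact isProbabilityMeasure_obliviousChannel hp g

/-! ### Convergence of uniform random coordinate descent -/

/-- The accumulated gap `∑_{s < t} (f(x_s) - f(z))` of the query points along the outputs `y`. -/
def cumGap {d : ℕ} (f : Vec d → ℝ) (z : Vec d) (q : ∀ t : ℕ, (Fin t → Vec d) → Vec d) :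
    ∀ t : ℕ, (Fin t → Vec d) → ℝ
  | 0, _ => 0
  | t + 1, y => cumGap f z q t (Fin.init y) + (f (q t (Fin.init y)) - f z)

section RandomCoordinateDescent

variable {d T : ℕ} {X : Set (Vec d)}

theorem cumGap_eq_sum (f : Vec d → ℝ) (z : Vec d) (q : ∀ t : ℕ, (Fin t → Vec d) → Vec d) (t : ℕ)
    (y : Fin t → Vec d) :
    cumGap f z q t y = ∑ s : Fin t, (f (q s fun i => y (Fin.castLE s.is_lt.le i)) - f z) := by
  induction t with
  | zero => simp [cumGap]
  | succ t ih =>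
    rw [cumGap, ih, Fin.sum_univ_castSucc]
    rfl

theorem cumGap_nonneg {f : Vec d → ℝ} {z : Vec d} {q : ∀ t : ℕ, (Fin t → Vec d) → Vec d}
    (h : ∀ t y, f z ≤ f (q t y)) (t : ℕ) (y : Fin t → Vec d) : 0 ≤ cumGap f z q t y := by
  rw [cumGap_eq_sum]
  exact Finset.sum_nonneg fun s _ => sub_nonneg.2 (h _ _)

theorem measurable_init (t : ℕ) :
    Measurable fun y : Fin (t + 1) → Vec d => (Fin.init y : Fin t → Vec d) :=
  measurable_pi_lambda _ fun j => measurable_pi_apply (X := fun _ => Vec d) j.castSucc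

theorem measurable_cumGap {f : Vec d → ℝ} (z : Vec d) {q : ∀ t : ℕ, (Fin t → Vec d) → Vec d}
    (h : ∀ t, Measurable fun y => f (q t y)) (t : ℕ) : Measurable (cumGap f z q t) := by
  induction t with
  | zero => exact measurable_const
  | succ t ih =>
    exact (ih.comp (measurable_init t)).add (((h t).comp (measurable_init t)).sub_const _)

theorem measurable_comp_of_continuousOn {α : Type*} [MeasurableSpace α] {f : Vec d → ℝ}
    (hf : ContinuousOn f X) {q : α → Vec d} (hq : Measurable q) (hqX : ∀ a, q a ∈ X) :
    Measurable fun a => f (q a) :=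
  (continuousOn_iff_continuous_domRestrict.1 hf).measurable.comp
    (hq.subtype_mk (h := hqX))

theorem Algorithm.measurable_query_seed (π : Algorithm X T) (u : unitInterval) (t : ℕ) :
    Measurable fun y : Fin t → Vec d => π.query t u y :=
  (π.measurable_query t).comp (measurable_const.prodMk measurable_id)

variable {B : ℝ} {f : Vec d → ℝ} {O : Kernel (Vec d) (Vec d)} {π : Algorithm X T}
  {S : ChannelStrategy (obliviousChannels d)} {x₁ : Vec d} {η : ℝ}

/-- The gaps are kept inside the potential instead of being subtracted, so, `z` being a minimizer,
all integrands are nonnegative and lower integrals suffice. -/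
theorem IsUniformRCD.lintegral_cumGap_le (hR : IsUniformRCD x₁ η π S) (hconv : Convex ℝ X)
    (hd : 0 < d) (hB : 0 ≤ B) (hη : 0 ≤ η) (h : (f, O) ∈ convexLipschitzClass X B) {z : Vec d}
    (hz : z ∈ X) (hmin : ∀ x ∈ X, f z ≤ f x) (u : unitInterval) (t : ℕ) :
    ∫⁻ y, ENNReal.ofReal (2 * η / d * cumGap f z (fun t y => π.query t u y) t y +
        ‖π.query t u y - z‖ ^ 2) ∂(transcript O π S u t) ≤
      ENNReal.ofReal (‖x₁ - z‖ ^ 2 + t * (η ^ 2 * B ^ 2 / d)) := by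
  have hM : IsMarkovKernel O := h.2.1
  have hS := isProbabilityMeasure_select S
  have hfc := (lipschitzOn_of_mem_class hB h).continuousOn
  have hmeas : ∀ t, Measurable fun y => ENNReal.ofReal (2 * η / d *
      cumGap f z (fun t y => π.query t u y) t y + ‖π.query t u y - z‖ ^ 2) := by
    intro t
    have h1 := measurable_cumGap z (fun t => measurable_comp_of_continuousOn hfc
      (π.measurable_query_seed u t) fun y => π.query_mem t u y) t
    have h2 := ((π.measurable_query_seed u t).sub_const z).norm
    exact ((h1.const_mul _).add (h2.pow_const 2)).ennreal_ofReal
  have hcum : ∀ t y, 0 ≤ cumGap f z (fun t y => π.query t u y) t y :=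
    cumGap_nonneg fun t y => hmin _ (π.query_mem t u y)
  induction t with
  | zero =>
    rw [lintegral_transcript_zero O π S u (hmeas 0), hR.2.1]
    simp [cumGap]
  | succ t ih =>
    have hP := isProbabilityMeasure_transcript O π S u hS t
    rw [lintegral_transcript_succ O π S u hS t (hmeas (t + 1))]
    have hstep : ∀ y : Fin t → Vec d,
        ∫⁻ g, ∫⁻ y', ENNReal.ofReal (2 * η / d * cumGap f z (fun t y => π.query t u y) (t + 1)
          (Fin.snoc y y') + ‖π.query (t + 1) u (Fin.snoc y y') - z‖ ^ 2) ∂(S.select t u y g)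
          ∂(O (π.query t u y)) ≤
        ENNReal.ofReal (2 * η / d * cumGap f z (fun t y => π.query t u y) t y +
        ‖π.query t u y - z‖ ^ 2) + ENNReal.ofReal (η ^ 2 * B ^ 2 / d) := by
      intro y
      have hx := π.query_mem t u y
      have hgap := sub_nonneg.2 (hmin _ hx)
      have hc := hcum t y
      rw [← ENNReal.ofReal_add (by positivity) (by positivity), hR.1 t u y]
      -- The constant `r` includes the current gap, already determined by `y`; the decrease in the
      -- step inequality cancels it.
      refine (lintegral_uniform_step_le hd hB hη h hx hz (2 * η / d *
        (cumGap f z (fun t y => π.query t u y) t y + (f (π.query t u y) - f z))) (by positivity)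
        ((hmeas (t + 1)).comp (measurable_snoc.comp (measurable_const.prodMk measurable_id)))
        fun y' => ENNReal.ofReal_le_ofReal ?_).trans_eq ?_
      · have := norm_nearest_sub_sq_le hconv (π.query_mem (t + 1) u (Fin.snoc y y'))
          (hR.2.2.1 t u y y') hz
        simp only [Function.comp_apply, id, cumGap, Fin.init_snoc]
        gcongr
      · congr 1
        ring
    refine (lintegral_mono hstep).trans ?_
    rw [lintegral_add_left (hmeas t), lintegral_const, measure_univ, mul_one]
    refine (add_le_add_left ih _).trans_eq ?_
    rw [← ENNReal.ofReal_add (by positivity) (by positivity)]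
    congr 1
    push_cast
    ring

/-- The convergence guarantee of uniform random coordinate descent with an arbitrary step size. -/
theorem IsUniformRCD.optError_le (hR : IsUniformRCD x₁ η π S) {D : ℝ} (hX : X ∈ domains d D)
    (hx₁ : x₁ ∈ X) (hd : 0 < d) (hT : 0 < T) (hB : 0 ≤ B) (hη : 0 < η)
    (h : (f, O) ∈ convexLipschitzClass X B) :
    optError f O π S ≤
      ENNReal.ofReal (d / (2 * η * T) * (D ^ 2 + T * (η ^ 2 * B ^ 2 / d))) := by
  have hd' : (0 : ℝ) < d := Nat.cast_pos.2 hd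
  have hT' : (0 : ℝ) < T := Nat.cast_pos.2 hT
  have hfc := (lipschitzOn_of_mem_class hB h).continuousOn
  obtain ⟨z, hz, hzmin⟩ := (isCompact_of_mem_domains hX).exists_isMinOn hX.1 hfc
  have hmin : ∀ x ∈ X, f z ≤ f x := fun x hx => hzmin hx
  have : Nonempty X := ⟨⟨z, hz⟩⟩
  have hinf : ⨅ x : X, f x = f z :=
    le_antisymm (ciInf_le ⟨f z, by rintro _ ⟨w, rfl⟩; exact hmin w w.2⟩ (⟨z, hz⟩ : X))
      (le_ciInf fun x => hmin x x.2)
  have hD : ‖x₁ - z‖ ^ 2 ≤ D ^ 2 := by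
    have := hX.2.2.2 _ hx₁ _ hz
    gcongr
  have hu : ∀ u, ∫⁻ y, ENNReal.ofReal (f (π.output u y) - ⨅ x : X, f x) ∂(transcript O π S u T) ≤
      ENNReal.ofReal (d / (2 * η * T) * (D ^ 2 + T * (η ^ 2 * B ^ 2 / d))) := by
    intro u
    have hpt : ∀ y, ENNReal.ofReal (f (π.output u y) - ⨅ x : X, f x) ≤
        ENNReal.ofReal (d / (2 * η * T)) * ENNReal.ofReal (2 * η / d *
          cumGap f z (fun t y => π.query t u y) T y + ‖π.query T u y - z‖ ^ 2) := by
      intro y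
      rw [← ENNReal.ofReal_mul (by positivity), hinf]
      refine ENNReal.ofReal_le_ofReal ?_
      have hJ : f (π.output u y) ≤ ∑ s : Fin T, (1 / (T : ℝ)) *
          f (π.query s u fun i => y (Fin.castLE s.is_lt.le i)) := by
        rw [hR.2.2.2, Finset.smul_sum]
        refine h.1.map_sum_le (fun _ _ => by positivity) ?_ fun s _ => π.query_mem _ _ _
        simp [hT'.ne']
      have hc : cumGap f z (fun t y => π.query t u y) T y =
          T * ((∑ s : Fin T, (1 / (T : ℝ)) *
            f (π.query s u fun i => y (Fin.castLE s.is_lt.le i))) - f z) := by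
        rw [cumGap_eq_sum, ← Finset.mul_sum, Finset.sum_sub_distrib]
        simp
        field_simp
      -- The point with index `T` is one past the last query made; it occurs only in this terminal
      -- distance, which is dropped.
      have hsq : 0 ≤ d / (2 * η * T) * ‖π.query T u y - z‖ ^ 2 := by positivity
      rw [mul_add, hc]
      have : d / (2 * η * T) * (2 * η / d * (T * ((∑ s : Fin T, (1 / (T : ℝ)) *
            f (π.query s u fun i => y (Fin.castLE s.is_lt.le i))) - f z))) =
          (∑ s : Fin T, (1 / (T : ℝ)) *
            f (π.query s u fun i => y (Fin.castLE s.is_lt.le i))) - f z := by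
        field_simp
      linarith
    refine (lintegral_mono hpt).trans ?_
    rw [lintegral_const_mul' _ _ ENNReal.ofReal_ne_top, ENNReal.ofReal_mul (by positivity)]
    gcongr
    refine (hR.lintegral_cumGap_le hX.2.2.1 hd hB hη.le h hz hmin u T).trans ?_
    gcongr
  refine (lintegral_mono hu).trans ?_
  simp

/-- The query points of projected coordinate descent with projection `P`. -/
def rcdQuery (P : Vec d → Vec d) (x₁ : Vec d) (η : ℝ) : ∀ t : ℕ, (Fin t → Vec d) → Vec d
  | 0, _ => x₁
  | t + 1, y => P (rcdQuery P x₁ η t (Fin.init y) - η • y (Fin.last t))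

theorem measurable_rcdQuery {P : Vec d → Vec d} (hP : Measurable P) (x₁ : Vec d) (η : ℝ) (t : ℕ) :
    Measurable (rcdQuery P x₁ η t) := by
  induction t with
  | zero => exact measurable_const
  | succ t ih =>
    exact hP.comp ((ih.comp (measurable_init t)).sub
      ((measurable_pi_apply (X := fun _ => Vec d) (Fin.last t)).const_smul η))

theorem exists_isUniformRCD {D : ℝ} (hX : X ∈ domains d D) (hx₁ : x₁ ∈ X) (hd : 0 < d)
    (hT : 0 < T) (η : ℝ) :
    ∃ (π : Algorithm X T) (S : ChannelStrategy (obliviousChannels d)), IsUniformRCD x₁ η π S := by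
  have hd' : (0 : ℝ) < d := Nat.cast_pos.2 hd
  have hT' : (0 : ℝ) < T := Nat.cast_pos.2 hT
  obtain ⟨P, hPX, hPmin, hPL⟩ := exists_nearest_point_map hX.1 hX.2.1 hX.2.2.1
  have hmem : ∀ t y, rcdQuery P x₁ η t y ∈ X := by
    intro t y
    cases t with
    | zero => exact hx₁
    | succ t => exact hPX _
  have hmeas := measurable_rcdQuery hPL.continuous.measurable x₁ η
  refine ⟨⟨fun t _ y => rcdQuery P x₁ η t y, fun _ y => (1 / (T : ℝ)) • ∑ t : Fin T,
    rcdQuery P x₁ η t fun i => y (Fin.castLE t.is_lt.le i), fun t _ y => hmem t y, ?_, ?_, ?_⟩,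
    ⟨fun _ _ _ => obliviousChannel fun _ => 1 / (d : ℝ), ?_, ?_⟩, ?_, ?_, ?_, ?_⟩
  · intro _ y
    rw [Finset.smul_sum]
    exact hX.2.2.1.sum_mem (fun _ _ => by positivity) (by simp [hT'.ne']) fun _ _ => hmem _ _
  · exact fun t => (hmeas t).comp measurable_snd
  · have hr : ∀ t : Fin T, Measurable fun y : Fin T → Vec d =>
        (fun i => y (Fin.castLE t.is_lt.le i) : Fin t → Vec d) := fun t =>
      measurable_pi_lambda _ fun i => measurable_pi_apply (X := fun _ => Vec d) _
    have hsum : Measurable fun y : Fin T → Vec d =>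
        ∑ t : Fin T, rcdQuery P x₁ η t fun i => y (Fin.castLE t.is_lt.le i) :=
      Finset.measurable_sum _ fun t _ => (hmeas t).comp (hr t)
    exact (hsum.const_smul (1 / (T : ℝ))).comp measurable_snd
  · exact fun _ _ _ => ⟨_, ⟨fun _ => by positivity, by simp [hd'.ne']⟩, rfl⟩
  · exact fun t => (obliviousChannel fun _ : Fin d => 1 / (d : ℝ)).measurable.comp measurable_snd
  · exact fun _ _ _ => rfl
  · exact fun _ _ => rfl
  · intro t _ y y' z hz
    have : rcdQuery P x₁ η (t + 1) (Fin.snoc y y') = P (rcdQuery P x₁ η t y - η • y') := by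
      simp [rcdQuery, Fin.init_snoc, Fin.snoc_last]
    simp only [this]
    exact hPmin _ z hz
  · exact fun _ _ => rfl

end RandomCoordinateDescent

/-! ### Hellinger affinity of adaptively sampled biased signs -/

/-- The sign `±1` encoded by a Boolean. -/
def boolSign (b : Bool) : ℝ := if b then 1 else -1

theorem boolSign_not (b : Bool) : boolSign (!b) = -boolSign b := by
  cases b <;> simp [boolSign]

theorem boolSign_mul_self (b : Bool) : boolSign b * boolSign b = 1 := by
  cases b <;> simp [boolSign]

theorem abs_boolSign (b : Bool) : |boolSign b| = 1 := by
  cases b <;> simp [boolSign]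

theorem boolSign_mul_eq_or (a b : Bool) :
    boolSign a * boolSign b = 1 ∨ boolSign a * boolSign b = -1 := by
  cases a <;> cases b <;> simp [boolSign]

/-- The sign vector `v` with the `i`-th sign flipped. -/
def flipAt {d : ℕ} (i : Fin d) (v : Fin d → Bool) : Fin d → Bool := Function.update v i (!v i)

theorem flipAt_involutive {d : ℕ} (i : Fin d) : Function.Involutive (flipAt i) := by
  intro v
  ext j
  by_cases hj : j = i
  · subst hj; simp [flipAt]
  · simp [flipAt, hj]

theorem sum_flipAt {d : ℕ} (i : Fin d) (F : (Fin d → Bool) → ℝ) :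
    ∑ v, F (flipAt i v) = ∑ v, F v :=
  Equiv.sum_comp (flipAt_involutive i).toPerm F

theorem flipAt_same {d : ℕ} (i : Fin d) (v : Fin d → Bool) : flipAt i v i = !v i := by
  simp [flipAt]

theorem flipAt_of_ne {d : ℕ} {i j : Fin d} (h : j ≠ i) (v : Fin d → Bool) :
    flipAt i v j = v j := by
  simp [flipAt, h]

theorem sum_fin_succ_fun {α M : Type*} [Fintype α] [AddCommMonoid M] (t : ℕ)
    (F : (Fin (t + 1) → α) → M) :
    ∑ a, F a = ∑ a : Fin t → α, ∑ x, F (Fin.snoc a x) := by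
  rw [← (Fin.snocEquiv fun _ : Fin (t + 1) => α).sum_comp, Fintype.sum_prod_type_right]
  rfl

/-- The probability of the outcomes `a` (a coordinate and a sign in each round), when the
coordinate in round `t` has law `p t` given the past and the sign of coordinate `i` is `v i` with
probability `(1 + ε) / 2`. -/
noncomputable def signWeight {d : ℕ} (p : ∀ t : ℕ, (Fin t → Fin d × Bool) → Fin d → ℝ) (ε : ℝ)
    (v : Fin d → Bool) : ∀ t : ℕ, (Fin t → Fin d × Bool) → ℝ
  | 0, _ => 1
  | t + 1, a => signWeight p ε v t (Fin.init a) * (p t (Fin.init a) (a (Fin.last t)).1 *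
      ((1 + ε * (boolSign (v (a (Fin.last t)).1) * boolSign (a (Fin.last t)).2)) / 2))

section SignWeight

variable {d : ℕ} {p : ∀ t : ℕ, (Fin t → Fin d × Bool) → Fin d → ℝ} {ε : ℝ}

theorem signWeight_snoc (v : Fin d → Bool) (t : ℕ) (a : Fin t → Fin d × Bool) (x : Fin d × Bool) :
    signWeight p ε v (t + 1) (Fin.snoc a x) = signWeight p ε v t a *
      (p t a x.1 * ((1 + ε * (boolSign (v x.1) * boolSign x.2)) / 2)) := by
  simp [signWeight, Fin.init_snoc, Fin.snoc_last]

theorem one_add_mul_sign_nonneg (h0 : 0 ≤ ε) (h1 : ε ≤ 1) (a b : Bool) :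
    0 ≤ (1 + ε * (boolSign a * boolSign b)) / 2 := by
  rcases boolSign_mul_eq_or a b with h | h <;> rw [h] <;> linarith

theorem signWeight_nonneg (hp : ∀ t a, p t a ∈ stdSimplex ℝ (Fin d)) (h0 : 0 ≤ ε) (h1 : ε ≤ 1)
    (v : Fin d → Bool) (t : ℕ) (a : Fin t → Fin d × Bool) : 0 ≤ signWeight p ε v t a := by
  induction t with
  | zero => exact zero_le_one
  | succ t ih =>
    exact mul_nonneg (ih _) (mul_nonneg ((hp _ _).1 _) (one_add_mul_sign_nonneg h0 h1 _ _))

theorem sum_signWeight (hp : ∀ t a, p t a ∈ stdSimplex ℝ (Fin d)) (v : Fin d → Bool) (t : ℕ) :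
    ∑ a, signWeight p ε v t a = 1 := by
  induction t with
  | zero => simp [signWeight]
  | succ t ih =>
    rw [sum_fin_succ_fun, ← ih]
    refine Finset.sum_congr rfl fun a _ => ?_
    simp_rw [signWeight_snoc, ← Finset.mul_sum]
    rw [Fintype.sum_prod_type]
    have : ∀ i : Fin d, ∑ s : Bool, p t a i * ((1 + ε * (boolSign (v i) * boolSign s)) / 2)
        = p t a i := by
      intro i
      simp [boolSign]
      ring
    simp_rw [this, (hp t a).2, mul_one]

/-- Coordinates other than `i` have the same sign law under both vectors and lose no affinity;
coordinate `i` retains the factor `√(1 - ε²) ≥ 1 - ε²`. -/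
theorem sqrt_step_ge (h0 : 0 ≤ ε) (h1 : ε ≤ 1) {q : Fin d → ℝ} (hq : q ∈ stdSimplex ℝ (Fin d))
    {w w' : ℝ} (hw : 0 ≤ w) (hw' : 0 ≤ w') (v : Fin d → Bool) (i : Fin d) :
    √(w * w') - ε ^ 2 * (q i * ((w + w') / 2)) ≤
      ∑ x : Fin d × Bool, √(w * (q x.1 * ((1 + ε * (boolSign (v x.1) * boolSign x.2)) / 2)) *
        (w' * (q x.1 * ((1 + ε * (boolSign (flipAt i v x.1) * boolSign x.2)) / 2)))) := by
  have hfac : ∀ x : Fin d × Bool,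
      √(w * (q x.1 * ((1 + ε * (boolSign (v x.1) * boolSign x.2)) / 2)) *
        (w' * (q x.1 * ((1 + ε * (boolSign (flipAt i v x.1) * boolSign x.2)) / 2)))) =
      √(w * w') * (q x.1 * √(((1 + ε * (boolSign (v x.1) * boolSign x.2)) / 2) *
        ((1 + ε * (boolSign (flipAt i v x.1) * boolSign x.2)) / 2))) := by
    intro x
    have e : w * (q x.1 * ((1 + ε * (boolSign (v x.1) * boolSign x.2)) / 2)) *
        (w' * (q x.1 * ((1 + ε * (boolSign (flipAt i v x.1) * boolSign x.2)) / 2))) =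
        (w * w') * (q x.1 ^ 2 * (((1 + ε * (boolSign (v x.1) * boolSign x.2)) / 2) *
        ((1 + ε * (boolSign (flipAt i v x.1) * boolSign x.2)) / 2))) := by ring
    rw [e, Real.sqrt_mul (mul_nonneg hw hw'), Real.sqrt_mul (sq_nonneg _), Real.sqrt_sq (hq.1 _)]
  have hcoord : ∀ j : Fin d, q j - (if j = i then ε ^ 2 * q j else 0) ≤
      ∑ s : Bool, q j * √(((1 + ε * (boolSign (v j) * boolSign s)) / 2) *
        ((1 + ε * (boolSign (flipAt i v j) * boolSign s)) / 2)) := by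
    intro j
    rw [← Finset.mul_sum]
    split_ifs with hj
    · subst hj
      have hs : ∀ s : Bool, (1 - ε ^ 2) / 2 ≤
          √(((1 + ε * (boolSign (v j) * boolSign s)) / 2) *
            ((1 + ε * (boolSign (flipAt j v j) * boolSign s)) / 2)) := by
        intro s
        rw [flipAt_same, boolSign_not]
        refine Real.le_sqrt_of_sq_le ?_
        have e2 : (boolSign (v j) * boolSign s) ^ 2 = 1 := by
          rcases boolSign_mul_eq_or (v j) s with h | h <;> rw [h] <;> norm_num
        have e : (1 + ε * (boolSign (v j) * boolSign s)) / 2 *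
          ((1 + ε * (-boolSign (v j) * boolSign s)) / 2) = (1 - ε ^ 2) / 4 := by
          linear_combination (-ε ^ 2 / 4) * e2
        rw [e]
        nlinarith [sq_nonneg ε, mul_nonneg h0 (sub_nonneg.2 h1)]
      have : q j * ((1 - ε ^ 2) / 2 + (1 - ε ^ 2) / 2) ≤ _ :=
        mul_le_mul_of_nonneg_left (add_le_add (hs true) (hs false)) (hq.1 j)
      rw [Fintype.sum_bool]
      linarith
    · simp_rw [flipAt_of_ne hj, ← pow_two,
        Real.sqrt_sq (one_add_mul_sign_nonneg h0 h1 _ _)]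
      simp [boolSign]
      ring_nf
      exact le_rfl
  have hsum : 1 - ε ^ 2 * q i ≤ ∑ j, ∑ s : Bool,
      q j * √(((1 + ε * (boolSign (v j) * boolSign s)) / 2) *
        ((1 + ε * (boolSign (flipAt i v j) * boolSign s)) / 2)) := by
    refine le_trans ?_ (Finset.sum_le_sum fun j _ => hcoord j)
    rw [Finset.sum_sub_distrib, hq.2]
    simp
  simp_rw [hfac, ← Finset.mul_sum]
  rw [Fintype.sum_prod_type]
  -- Replacing the geometric mean in the loss term by the arithmetic mean makes the loss linear in
  -- the weights, so that it can be summed over `v`.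
  have hA : √(w * w') ≤ (w + w') / 2 := by
    refine Real.sqrt_le_iff.2 ⟨by positivity, ?_⟩
    nlinarith [sq_nonneg (w - w')]
  have h3 := mul_le_mul_of_nonneg_left hsum (Real.sqrt_nonneg (w * w'))
  have h4 := mul_le_mul_of_nonneg_left hA (mul_nonneg (sq_nonneg ε) (hq.1 i))
  linarith

/-- After any history the sampling probabilities add up to one, so a round costs `ε²` in total over
all `i`, not `ε²` for each `i`. This is the source of the extra factor `√d` in the rate. -/
theorem sum_sum_sqrt_signWeight_ge (hp : ∀ t a, p t a ∈ stdSimplex ℝ (Fin d)) (h0 : 0 ≤ ε)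
    (h1 : ε ≤ 1) (t : ℕ) :
    (2 : ℝ) ^ d * (d - ε ^ 2 * t) ≤ ∑ a, ∑ i, ∑ v,
      √(signWeight p ε v t a * signWeight p ε (flipAt i v) t a) := by
  induction t with
  | zero => simp [signWeight, mul_comm]
  | succ t ih =>
    rw [sum_fin_succ_fun]
    have hstep : ∀ a : Fin t → Fin d × Bool,
        (∑ i, ∑ v, √(signWeight p ε v t a * signWeight p ε (flipAt i v) t a)) -
          ε ^ 2 * ∑ v, signWeight p ε v t a ≤
        ∑ x, ∑ i, ∑ v, √(signWeight p ε v (t + 1) (Fin.snoc a x) *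
          signWeight p ε (flipAt i v) (t + 1) (Fin.snoc a x)) := by
      intro a
      have hswap : ∑ x, ∑ i, ∑ v, √(signWeight p ε v (t + 1) (Fin.snoc a x) *
          signWeight p ε (flipAt i v) (t + 1) (Fin.snoc a x)) =
          ∑ i, ∑ v, ∑ x, √(signWeight p ε v (t + 1) (Fin.snoc a x) *
          signWeight p ε (flipAt i v) (t + 1) (Fin.snoc a x)) := by
        rw [Finset.sum_comm]
        exact Finset.sum_congr rfl fun i _ => Finset.sum_comm
      have hmass : ∑ i, ∑ v, p t a i * ((signWeight p ε v t a +
          signWeight p ε (flipAt i v) t a) / 2) = ∑ v, signWeight p ε v t a := by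
        simp_rw [← Finset.mul_sum, ← Finset.sum_div, Finset.sum_add_distrib,
          sum_flipAt _ fun v => signWeight p ε v t a]
        rw [← Finset.sum_mul, (hp t a).2]
        ring
      rw [hswap, ← hmass]
      simp_rw [Finset.mul_sum, ← Finset.sum_sub_distrib, signWeight_snoc]
      exact Finset.sum_le_sum fun i _ => Finset.sum_le_sum fun v _ =>
        sqrt_step_ge h0 h1 (hp t a) (signWeight_nonneg hp h0 h1 _ _ _)
          (signWeight_nonneg hp h0 h1 _ _ _) v i
    refine le_trans ?_ (Finset.sum_le_sum fun a _ => hstep a)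
    rw [Finset.sum_sub_distrib, ← Finset.mul_sum, Finset.sum_comm (f := fun a v =>
      signWeight p ε v t a)]
    simp_rw [sum_signWeight hp]
    simp
    linarith

/-- Weighted AM-GM on `|√w - √w'| · (√w + √w')` gives this with `√5 ≤ 9 / 4`. Linear in the
affinity, it bounds total variation by Hellinger affinity after summation, without Cauchy–Schwarz.
-/
theorem abs_sub_le_sqrt_mul {w w' : ℝ} (hw : 0 ≤ w) (hw' : 0 ≤ w') :
    |w - w'| ≤ 9 / 4 * (w + w') - 4 * √(w * w') := by
  rw [Real.sqrt_mul hw]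
  have h1 := Real.sq_sqrt hw
  have h2 := Real.sq_sqrt hw'
  rw [abs_sub_le_iff]
  constructor
  · nlinarith [sq_nonneg (5 * √w - 8 * √w'), sq_nonneg (√w')]
  · nlinarith [sq_nonneg (8 * √w - 5 * √w'), sq_nonneg (√w)]

/-- If the signs are only weakly biased, then no estimate `h` built from `t` observations is
well correlated with `v`, on average over `v`. -/
theorem sum_correlation_le (hp : ∀ t a, p t a ∈ stdSimplex ℝ (Fin d)) (h0 : 0 ≤ ε)
    (h1 : ε ≤ 1) (t : ℕ) (ht : ε ^ 2 * t ≤ d / 16) (h : (Fin t → Fin d × Bool) → Fin d → ℝ)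
    (hh : ∀ a i, |h a i| ≤ 1) :
    ∑ v, ∑ a, signWeight p ε v t a * ∑ i, boolSign (v i) * h a i ≤ (2 : ℝ) ^ d * (3 / 8 * d) := by
  have hnn := signWeight_nonneg hp h0 h1 (t := t)
  have hpt : ∀ a i, ∑ v, signWeight p ε v t a * (boolSign (v i) * h a i) ≤
      1 / 2 * ∑ v, (9 / 4 * (signWeight p ε v t a + signWeight p ε (flipAt i v) t a) -
        4 * √(signWeight p ε v t a * signWeight p ε (flipAt i v) t a)) := by
    intro a i
    -- Pair `v` with its flip at `i`: the sign changes while `h a i`, which does not see `v`, stays.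
    have hflip : ∑ v, signWeight p ε v t a * (boolSign (v i) * h a i) =
        ∑ v, 1 / 2 * ((signWeight p ε v t a - signWeight p ε (flipAt i v) t a) *
          (boolSign (v i) * h a i)) := by
      have := sum_flipAt i fun v => signWeight p ε v t a * (boolSign (v i) * h a i)
      simp only [flipAt_same, boolSign_not] at this
      rw [← Finset.mul_sum]
      simp_rw [sub_mul, Finset.sum_sub_distrib]
      have e : ∑ v, signWeight p ε (flipAt i v) t a * (boolSign (v i) * h a i) =
          - ∑ v, signWeight p ε v t a * (boolSign (v i) * h a i) := by
        rw [← this, ← Finset.sum_neg_distrib]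
        exact Finset.sum_congr rfl fun v _ => by ring
      rw [e]
      ring
    rw [hflip, ← Finset.mul_sum]
    gcongr with v _
    refine (le_abs_self _).trans ?_
    rw [abs_mul, abs_mul, abs_boolSign, one_mul]
    exact (mul_le_of_le_one_right (abs_nonneg _) (hh a i)).trans
      (abs_sub_le_sqrt_mul (hnn _ _) (hnn _ _))
  have hA := sum_sum_sqrt_signWeight_ge hp h0 h1 t
  have hsplit : ∀ a i, ∑ v, (9 / 4 * (signWeight p ε v t a + signWeight p ε (flipAt i v) t a) -
      4 * √(signWeight p ε v t a * signWeight p ε (flipAt i v) t a)) =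
      9 / 4 * (2 * ∑ v, signWeight p ε v t a) -
        4 * ∑ v, √(signWeight p ε v t a * signWeight p ε (flipAt i v) t a) := by
    intro a i
    rw [Finset.sum_sub_distrib, ← Finset.mul_sum, ← Finset.mul_sum, Finset.sum_add_distrib,
      sum_flipAt i fun v => signWeight p ε v t a, two_mul]
  have hmass : ∑ a, ∑ v, signWeight p ε v t a = (2 : ℝ) ^ d := by
    rw [Finset.sum_comm]
    simp_rw [sum_signWeight hp]
    simp
  calc ∑ v, ∑ a, signWeight p ε v t a * ∑ i, boolSign (v i) * h a i
      = ∑ a, ∑ i, ∑ v, signWeight p ε v t a * (boolSign (v i) * h a i) := by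
        rw [Finset.sum_comm]
        refine Finset.sum_congr rfl fun a _ => ?_
        simp_rw [Finset.mul_sum]
        exact Finset.sum_comm
    _ ≤ ∑ a, ∑ i, 1 / 2 * ∑ v, (9 / 4 * (signWeight p ε v t a +
          signWeight p ε (flipAt i v) t a) -
          4 * √(signWeight p ε v t a * signWeight p ε (flipAt i v) t a)) :=
        Finset.sum_le_sum fun a _ => Finset.sum_le_sum fun i _ => hpt a i
    _ = 1 / 2 * (9 / 4 * (d * (2 * ∑ a, ∑ v, signWeight p ε v t a)) - 4 * ∑ a, ∑ i, ∑ v,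
          √(signWeight p ε v t a * signWeight p ε (flipAt i v) t a)) := by
        simp_rw [hsplit, ← Finset.mul_sum, Finset.sum_sub_distrib, ← Finset.mul_sum]
        simp [← Finset.mul_sum]
        ring
    -- The affinity sum is at least `2^d · (15/16) d`, and `(9/2 - 15/4) / 2 = 3/8`.
    _ ≤ (2 : ℝ) ^ d * (3 / 8 * d) := by
        rw [hmass]
        have h2 : (0 : ℝ) < 2 ^ d := by positivity
        have := mul_le_mul_of_nonneg_left ht h2.le
        nlinarith

end SignWeight

/-! ### The hard instances on the cube -/

section HardInstance

variable {d T : ℕ}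

/-- The vector of signs encoded by `v`. -/
noncomputable def signVec (v : Fin d → Bool) : Vec d := WithLp.toLp 2 fun i => boolSign (v i)

theorem signVec_apply (v : Fin d → Bool) (i : Fin d) : signVec v i = boolSign (v i) := rfl

theorem norm_signVec_sq (v : Fin d → Bool) : ‖signVec v‖ ^ 2 = d := by
  rw [EuclideanSpace.real_norm_sq_eq]
  simp [signVec_apply, pow_two, boolSign_mul_self]

/-- The law of `± c v`, where the sign is positive with probability `(1 + ε) / 2`. -/
noncomputable def signLaw (ε c : ℝ) (v : Fin d → Bool) : Measure (Vec d) :=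
  ∑ s : Bool, ENNReal.ofReal ((1 + ε * boolSign s) / 2) •
    Measure.dirac ((c * boolSign s) • signVec v)

theorem one_add_boolSign_nonneg {ε : ℝ} (h0 : 0 ≤ ε) (h1 : ε ≤ 1) (s : Bool) :
    0 ≤ (1 + ε * boolSign s) / 2 := by
  cases s <;> simp [boolSign] <;> linarith

theorem lintegral_signLaw (ε c : ℝ) (v : Fin d → Bool) {F : Vec d → ℝ≥0∞} (hF : Measurable F) :
    ∫⁻ g, F g ∂(signLaw ε c v) =
      ∑ s : Bool, ENNReal.ofReal ((1 + ε * boolSign s) / 2) * F ((c * boolSign s) • signVec v) := by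
  rw [signLaw, lintegral_finsetSum_measure]
  refine Finset.sum_congr rfl fun s _ => ?_
  rw [lintegral_smul_measure, lintegral_dirac' _ hF, smul_eq_mul]

theorem isProbabilityMeasure_signLaw {ε : ℝ} (h0 : 0 ≤ ε) (h1 : ε ≤ 1) (c : ℝ)
    (v : Fin d → Bool) : IsProbabilityMeasure (signLaw ε c v) := by
  constructor
  rw [← lintegral_one, lintegral_signLaw _ _ _ measurable_const]
  simp only [mul_one]
  rw [← ENNReal.ofReal_sum_of_nonneg fun s _ => one_add_boolSign_nonneg h0 h1 s]
  simp [boolSign]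
  ring

theorem integral_signLaw {ε : ℝ} (h0 : 0 ≤ ε) (h1 : ε ≤ 1) (c : ℝ) (v : Fin d → Bool) :
    ∫ g, g ∂(signLaw ε c v) = (ε * c) • signVec v := by
  rw [signLaw, integral_finsetSum_measure fun s _ =>
    (integrable_dirac enorm_lt_top).smul_measure ENNReal.ofReal_ne_top]
  simp_rw [integral_smul_measure, integral_dirac,
    ENNReal.toReal_ofReal (one_add_boolSign_nonneg h0 h1 _)]
  rw [Fintype.sum_bool, smul_smul, smul_smul, ← add_smul]
  congr 1
  simp [boolSign]
  ring

theorem ae_signLaw (ε c : ℝ) (v : Fin d → Bool) :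
    ∀ᵐ g ∂(signLaw ε c v), ‖g‖ ^ 2 = c ^ 2 * d := by
  rw [signLaw, ae_finsetSum_measure_iff]
  intro s _
  refine Measure.ae_smul_measure ?_ _
  rw [ae_dirac_eq, Filter.eventually_pure]
  rw [norm_smul, mul_pow, norm_signVec_sq, Real.norm_eq_abs, sq_abs, mul_pow, pow_two (boolSign s),
    boolSign_mul_self, mul_one]

theorem mem_convexLipschitzClass_signLaw {ε : ℝ} (h0 : 0 ≤ ε) (h1 : ε ≤ 1) {c B : ℝ}
    (hc : c ^ 2 * d = B ^ 2) {X : Set (Vec d)} (hX : Convex ℝ X) (v : Fin d → Bool) :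
    ((fun x => inner ℝ ((ε * c) • signVec v) x), Kernel.const (Vec d) (signLaw ε c v)) ∈
      convexLipschitzClass X B := by
  have := isProbabilityMeasure_signLaw h0 h1 c v
  refine ⟨(innerₗ (Vec d) ((ε * c) • signVec v)).convexOn hX, inferInstance, fun x _ => ⟨?_, ?_⟩⟩
  · intro y _
    simp only [Kernel.const_apply]
    rw [integral_signLaw h0 h1, inner_sub_right]
    linarith
  · rw [Kernel.const_apply]
    filter_upwards [ae_signLaw ε c v] with g hg
    rw [hg, hc]

/-- Through an oblivious channel, `signLaw` looks like independent biased signs. -/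
theorem lintegral_channel_signLaw (ε c : ℝ) (v : Fin d → Bool)
    {q : Fin d → ℝ} (hq : q ∈ stdSimplex ℝ (Fin d)) {F : Vec d → ℝ≥0∞} (hF : Measurable F) :
    ∫⁻ g, ∫⁻ y', F y' ∂(obliviousChannel q g) ∂(signLaw ε c v) =
      ∑ x : Fin d × Bool, ENNReal.ofReal
        (q x.1 * ((1 + ε * (boolSign (v x.1) * boolSign x.2)) / 2)) *
        F (EuclideanSpace.single x.1 (c * boolSign x.2)) := by
  rw [lintegral_signLaw _ _ _ hF.lintegral_kernel, Fintype.sum_prod_type]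
  simp_rw [lintegral_obliviousChannel _ _ _ hF, Finset.mul_sum]
  rw [Finset.sum_comm]
  refine Finset.sum_congr rfl fun i _ => ?_
  simp_rw [ENNReal.ofReal_mul (hq.1 i), mul_assoc, mul_left_comm _ (ENNReal.ofReal (q i)),
    ← Finset.mul_sum, PiLp.smul_apply, signVec_apply, smul_eq_mul]
  congr 1
  -- The observed sign is `s` times the sign of `v i`, so a negative coordinate swaps the two
  -- summands.
  rcases hv : v i <;> simp [boolSign]
  rw [add_comm]

/-- The channel output that reveals the sign `x.2` of the coordinate `x.1`. -/
noncomputable def outcomeVec (c : ℝ) (x : Fin d × Bool) : Vec d :=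
  EuclideanSpace.single x.1 (c * boolSign x.2)

theorem outcomeVec_snoc (c : ℝ) (t : ℕ) (a : Fin t → Fin d × Bool) (x : Fin d × Bool) :
    (fun k => outcomeVec c ((Fin.snoc a x : Fin (t + 1) → Fin d × Bool) k)) =
      (Fin.snoc (fun k => outcomeVec c (a k)) (outcomeVec c x) : Fin (t + 1) → Vec d) := by
  funext k
  refine Fin.lastCases ?_ (fun i => ?_) k <;> simp

variable {X : Set (Vec d)} (π : Algorithm X T) (S : ChannelStrategy (obliviousChannels d))

/-- The probability vector of the channel that `S` selects. -/
noncomputable def ChannelStrategy.prob (t : ℕ) (u : unitInterval) (y : Fin t → Vec d) :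
    Fin d → ℝ :=
  (S.select_mem t u y).choose

theorem ChannelStrategy.prob_mem (t : ℕ) (u : unitInterval) (y : Fin t → Vec d) :
    S.prob t u y ∈ stdSimplex ℝ (Fin d) :=
  (S.select_mem t u y).choose_spec.1

theorem ChannelStrategy.select_eq (t : ℕ) (u : unitInterval) (y : Fin t → Vec d) :
    S.select t u y = obliviousChannel (S.prob t u y) :=
  (S.select_mem t u y).choose_spec.2

/-- `prob` comes from choice, but the channel determines it: on the all-ones input, the expected
`i`-th output coordinate is the probability of `i`. -/
theorem ChannelStrategy.measurable_prob (t : ℕ) (y : Fin t → Vec d) (i : Fin d) :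
    Measurable fun u => S.prob t u y i := by
  have hc : Measurable fun z : Vec d => ENNReal.ofReal (z i) :=
    (PiLp.continuous_apply 2 (fun _ : Fin d => ℝ) i).measurable.ennreal_ofReal
  have h := (Measure.measurable_lintegral hc).comp ((S.measurable_select t).comp
    ((measurable_id.prodMk (measurable_const (a := y))).prodMk
      (measurable_const (a := (WithLp.toLp 2 fun _ => 1 : Vec d)))))
  convert h.ennreal_toReal using 2 with u
  simp only [Function.comp_apply, id, S.select_eq]
  rw [lintegral_obliviousChannel _ _ _ hc, Finset.sum_eq_single i]
  · simp [ENNReal.toReal_ofReal ((S.prob_mem t u y).1 i)]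
  · intro j _ hj
    simp [hj.symm]
  · simp

/-- The coordinate laws of `S`, as functions of the outcomes. -/
noncomputable def ChannelStrategy.outcomeProb (c : ℝ) (u : unitInterval) (t : ℕ)
    (a : Fin t → Fin d × Bool) : Fin d → ℝ :=
  S.prob t u fun k => outcomeVec c (a k)

/-- The oracle ignores the query point, so only the channel choices shape the transcript, and
expectations become finite sums over coordinate–sign outcomes. -/
theorem lintegral_transcript_signLaw {ε : ℝ} (h0 : 0 ≤ ε) (h1 : ε ≤ 1) (c : ℝ)
    (v : Fin d → Bool) (u : unitInterval) (t : ℕ) {F : (Fin t → Vec d) → ℝ≥0∞}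
    (hF : Measurable F) :
    ∫⁻ y, F y ∂(transcript (Kernel.const (Vec d) (signLaw ε c v)) π S u t) =
      ∑ a, ENNReal.ofReal (signWeight (S.outcomeProb c u) ε v t a) *
        F fun k => outcomeVec c (a k) := by
  have := isProbabilityMeasure_signLaw h0 h1 c v
  have hS := isProbabilityMeasure_select S
  induction t with
  | zero =>
    rw [lintegral_transcript_zero _ π S u hF]
    simp [signWeight]
    congr 1
    exact Subsingleton.elim _ _
  | succ t ih =>
    rw [lintegral_transcript_succ _ π S u hS t hF, ih (measurable_lintegral_round _ π S u hS t hF),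
      sum_fin_succ_fun]
    refine Finset.sum_congr rfl fun a _ => ?_
    have hsn : Measurable fun y' => F (Fin.snoc (fun k => outcomeVec c (a k)) y') :=
      (hF.comp measurable_snoc).comp (measurable_const.prodMk measurable_id)
    rw [S.select_eq, Kernel.const_apply, lintegral_channel_signLaw ε c v (S.prob_mem _ _ _) hsn,
      Finset.mul_sum]
    refine Finset.sum_congr rfl fun x _ => ?_
    rw [signWeight_snoc, ENNReal.ofReal_mul (signWeight_nonneg
      (p := S.outcomeProb c u) (fun _ _ => S.prob_mem _ _ _) h0 h1 _ _ _), mul_assoc, outcomeVec_snoc]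
    rfl

theorem measurable_signWeight (ε c : ℝ) (v : Fin d → Bool) (t : ℕ) (a : Fin t → Fin d × Bool) :
    Measurable fun u => signWeight (S.outcomeProb c u) ε v t a := by
  induction t with
  | zero => exact measurable_const
  | succ t ih => exact (ih _).mul ((S.measurable_prob t _ _).mul_const _)

/-- The cube with half side length `r`. -/
def cube (d : ℕ) (r : ℝ) : Set (Vec d) := {x | ∀ i, |x i| ≤ r}

theorem cube_mem_domains {D : ℝ} (hD : 0 ≤ D) (hd : 0 < d) :
    cube d (D / (2 * √(d : ℝ))) ∈ domains d D := by
  have hd' : (0 : ℝ) < d := Nat.cast_pos.2 hd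
  refine ⟨⟨0, fun i => ?_⟩, ?_, ?_, ?_⟩
  · simp only [PiLp.zero_apply, abs_zero]
    positivity
  · simp only [cube, Set.ofPred_forall]
    exact isClosed_iInter fun i => isClosed_le
      (PiLp.continuous_apply 2 (fun _ : Fin d => ℝ) i).abs continuous_const
  · intro x hx y hy a b ha hb hab i
    simp only [PiLp.add_apply, PiLp.smul_apply, smul_eq_mul]
    calc |a * x i + b * y i| ≤ |a * x i| + |b * y i| := abs_add_le _ _
      _ = a * |x i| + b * |y i| := by rw [abs_mul, abs_mul, abs_of_nonneg ha, abs_of_nonneg hb]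
      _ ≤ a * (D / (2 * √(d : ℝ))) + b * (D / (2 * √(d : ℝ))) := by
        gcongr
        exacts [hx i, hy i]
      _ = D / (2 * √(d : ℝ)) := by rw [← add_mul, hab, one_mul]
  · intro x hx y hy
    refine (sq_le_sq₀ (norm_nonneg _) hD).1 ?_
    rw [EuclideanSpace.real_norm_sq_eq]
    have hi : ∀ i, (x - y) i ^ 2 ≤ D ^ 2 / d := by
      intro i
      have h1 : |(x - y) i| ≤ D / √(d : ℝ) := by
        have := (abs_sub (x i) (y i)).trans (add_le_add (hx i) (hy i))
        refine this.trans_eq ?_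
        field_simp
        ring
      rw [← sq_abs]
      calc |(x - y) i| ^ 2 ≤ (D / √(d : ℝ)) ^ 2 := by gcongr
        _ = D ^ 2 / d := by rw [div_pow, Real.sq_sqrt hd'.le]
    calc ∑ i, (x - y) i ^ 2 ≤ ∑ _i : Fin d, D ^ 2 / d := Finset.sum_le_sum fun i _ => hi i
      _ = D ^ 2 := by
        simp
        field_simp

/-- Comparison with the vertex `-r v`. The vector `-x / r` acts as an estimate of `v`, so a small
gap forces a high correlation. -/
theorem gap_cube_ge {ε c r : ℝ} (hεc : 0 ≤ ε * c) (hr : 0 < r) (v : Fin d → Bool) (x : Vec d) :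
    ε * c * r * (d - ∑ i, boolSign (v i) * (-(x i) / r)) ≤
      inner ℝ ((ε * c) • signVec v) x -
        ⨅ x : cube d r, inner ℝ ((ε * c) • signVec v) (x : Vec d) := by
  have hinner : ∀ x : Vec d, inner ℝ ((ε * c) • signVec v) x =
      ε * c * ∑ i, boolSign (v i) * x i := by
    intro x
    rw [real_inner_smul_left, PiLp.inner_apply]
    simp [signVec_apply, mul_comm]
  have hmem : -(r • signVec v) ∈ cube d r := by
    intro i
    simp [signVec_apply, abs_mul, abs_boolSign, abs_of_pos hr]
  have hbdd : BddBelow (Set.range fun x : cube d r =>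
      inner ℝ ((ε * c) • signVec v) (x : Vec d)) := by
    refine ⟨ε * c * ∑ _i : Fin d, -r, ?_⟩
    rintro _ ⟨x, rfl⟩
    simp only [hinner]
    gcongr with i _
    have h1 := (abs_le.1 ((abs_mul (boolSign (v i)) _).le.trans
      ((abs_boolSign (v i)).symm ▸ (one_mul |(x : Vec d) i|).le.trans (x.2 i)))).1
    exact h1
  have hinf := ciInf_le hbdd ⟨_, hmem⟩
  simp only [hinner] at hinf ⊢
  have e1 : ∑ i, boolSign (v i) * (-(r • signVec v)) i = -(r * d) := by
    simp [signVec_apply, mul_left_comm _ r, boolSign_mul_self, mul_comm]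
  have e2 : ∑ i, boolSign (v i) * (-(x i) / r) = -(∑ i, boolSign (v i) * x i) / r := by
    rw [neg_div, Finset.sum_div, ← Finset.sum_neg_distrib]
    exact Finset.sum_congr rfl fun i _ => by ring
  rw [e1] at hinf
  rw [e2]
  have e3 : ε * c * r * (d - -(∑ i, boolSign (v i) * x i) / r) =
      ε * c * (∑ i, boolSign (v i) * x i) - ε * c * -(r * d) := by
    field_simp
    ring
  linarith

/-- Lower bound for the sum over `v` of the errors on the instances `signLaw ε c v`. -/
theorem sum_optError_signLaw_ge {ε c r : ℝ} (h0 : 0 ≤ ε) (h1 : ε ≤ 1) (hc : 0 ≤ c) (hr : 0 < r)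
    (ht : ε ^ 2 * T ≤ d / 16) (π : Algorithm (cube d r) T) :
    ENNReal.ofReal (2 ^ d * (ε * c * r * (5 / 8 * d))) ≤
      ∑ v : Fin d → Bool, optError (fun x => inner ℝ ((ε * c) • signVec v) x)
        (Kernel.const (Vec d) (signLaw ε c v)) π S := by
  have hεc := mul_nonneg h0 hc
  set gap : (Fin d → Bool) → Vec d → ℝ := fun v x => inner ℝ ((ε * c) • signVec v) x -
        ⨅ x : cube d r, inner ℝ ((ε * c) • signVec v) (x : Vec d) with hgap
  have hgm : ∀ v, Measurable (gap v) := fun v =>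
    ((continuous_const.inner continuous_id).measurable).sub_const _
  have herr : ∀ v, optError (fun x => inner ℝ ((ε * c) • signVec v) x)
        (Kernel.const (Vec d) (signLaw ε c v)) π S = ∫⁻ u : unitInterval,
        ∑ a, ENNReal.ofReal (signWeight (S.outcomeProb c u) ε v T a) *
          ENNReal.ofReal (gap v (π.output u fun k => outcomeVec c (a k))) := by
    intro v
    refine lintegral_congr fun u => ?_
    exact lintegral_transcript_signLaw π S h0 h1 c v u T (F := fun y =>
      ENNReal.ofReal (gap v (π.output u y))) (((hgm v).comp (π.measurable_output.comp
        (measurable_const.prodMk measurable_id))).ennreal_ofReal)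
  simp_rw [herr]
  rw [← lintegral_finsetSum]
  swap
  · intro v _
    refine Finset.measurable_sum _ fun a _ => (measurable_signWeight S ε c v T a).ennreal_ofReal.mul
      (((hgm v).comp (π.measurable_output.comp
        (measurable_id.prodMk measurable_const))).ennreal_ofReal)
  -- The bound holds for each seed separately, so randomization does not help.
  have hu : ∀ u : unitInterval, ENNReal.ofReal (2 ^ d * (ε * c * r * (5 / 8 * d))) ≤
      ∑ v, ∑ a, ENNReal.ofReal (signWeight (S.outcomeProb c u) ε v T a) *
          ENNReal.ofReal (gap v (π.output u fun k => outcomeVec c (a k))) := by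
    intro u
    have hp : ∀ t a, S.outcomeProb c u t a ∈ stdSimplex ℝ (Fin d) := fun _ _ => S.prob_mem _ _ _
    have hnn := signWeight_nonneg hp h0 h1 (t := T)
    have hg : ∀ v (a : Fin T → Fin d × Bool), ε * c * r * (d - ∑ i, boolSign (v i) *
        (-((π.output u fun k => outcomeVec c (a k)) i) / r)) ≤
        gap v (π.output u fun k => outcomeVec c (a k)) := fun v a => gap_cube_ge hεc hr v _
    have hcorr := sum_correlation_le hp h0 h1 T ht
      (fun a i => -((π.output u fun k => outcomeVec c (a k)) i) / r) (fun a i => by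
        rw [abs_div, abs_neg, abs_of_pos hr, div_le_one hr]
        exact π.output_mem u _ i)
    have hsum : ∑ v, ∑ a, signWeight (S.outcomeProb c u) ε v T a * (ε * c * r * (d -
        ∑ i, boolSign (v i) * (-((π.output u fun k => outcomeVec c (a k)) i) / r))) =
        ε * c * r * (2 ^ d * d - ∑ v, ∑ a, signWeight (S.outcomeProb c u) ε v T a *
          ∑ i, boolSign (v i) * (-((π.output u fun k => outcomeVec c (a k)) i) / r)) := by
      simp_rw [mul_left_comm _ (ε * c * r), ← Finset.mul_sum, mul_sub, Finset.sum_sub_distrib,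
        ← Finset.sum_mul, sum_signWeight hp]
      simp
      ring
    calc ENNReal.ofReal (2 ^ d * (ε * c * r * (5 / 8 * d)))
        ≤ ENNReal.ofReal (∑ v, ∑ a, signWeight (S.outcomeProb c u) ε v T a * (ε * c * r * (d -
        ∑ i, boolSign (v i) * (-((π.output u fun k => outcomeVec c (a k)) i) / r)))) := by
          refine ENNReal.ofReal_le_ofReal ?_
          rw [hsum]
          have := mul_le_mul_of_nonneg_left hcorr (mul_nonneg hεc hr.le)
          linarith
      _ ≤ ∑ v, ENNReal.ofReal (∑ a, signWeight (S.outcomeProb c u) ε v T a * (ε * c * r * (d -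
        ∑ i, boolSign (v i) * (-((π.output u fun k => outcomeVec c (a k)) i) / r)))) :=
          Finset.le_sum_of_subadditive _ ENNReal.ofReal_zero.le
            (fun _ _ => ENNReal.ofReal_add_le) _ _
      _ ≤ ∑ v, ∑ a, ENNReal.ofReal (signWeight (S.outcomeProb c u) ε v T a * (ε * c * r * (d -
        ∑ i, boolSign (v i) * (-((π.output u fun k => outcomeVec c (a k)) i) / r)))) :=
          Finset.sum_le_sum fun v _ => Finset.le_sum_of_subadditive _ ENNReal.ofReal_zero.le
            (fun _ _ => ENNReal.ofReal_add_le) _ _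
      _ ≤ _ := by
          refine Finset.sum_le_sum fun v _ => Finset.sum_le_sum fun a _ => ?_
          rw [ENNReal.ofReal_mul (hnn v a)]
          gcongr
          exact hg v a
  calc ENNReal.ofReal (2 ^ d * (ε * c * r * (5 / 8 * d)))
      = ∫⁻ _u : unitInterval, ENNReal.ofReal (2 ^ d * (ε * c * r * (5 / 8 * d))) := by simp
    _ ≤ _ := lintegral_mono hu

end HardInstance

/-- The supremum over the class dominates the average over the `2^d` sign vectors. -/
theorem minmaxError_cube_ge {d T : ℕ} {ε c r B : ℝ} (h0 : 0 ≤ ε) (h1 : ε ≤ 1) (hc : 0 ≤ c)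
    (hr : 0 < r) (hcB : c ^ 2 * d = B ^ 2) (ht : ε ^ 2 * T ≤ d / 16) (hX : Convex ℝ (cube d r)) :
    ENNReal.ofReal (ε * c * r * (5 / 8 * d)) ≤
      minmaxError (cube d r) (convexLipschitzClass (cube d r) B) T (obliviousChannels d) := by
  refine le_iInf₂ fun π S => ?_
  have hsum := sum_optError_signLaw_ge S h0 h1 hc hr ht π
  have hle : ∀ v : Fin d → Bool, optError (fun x => inner ℝ ((ε * c) • signVec v) x)
      (Kernel.const (Vec d) (signLaw ε c v)) π S ≤
      ⨆ fO ∈ convexLipschitzClass (cube d r) B, optError fO.1 fO.2 π S := fun v =>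
    le_iSup₂_of_le (f := fun (fO : (Vec d → ℝ) × Kernel (Vec d) (Vec d)) _ =>
      optError fO.1 fO.2 π S) _ (mem_convexLipschitzClass_signLaw h0 h1 hcB hX v) le_rfl
  have h := hsum.trans (Finset.sum_le_sum fun v _ => hle v)
  rw [Finset.sum_const, Finset.card_univ, nsmul_eq_mul, ENNReal.ofReal_mul (by positivity)] at h
  have e : ENNReal.ofReal (2 ^ d) = ((Fintype.card (Fin d → Bool) : ℕ) : ℝ≥0∞) := by
    rw [← ENNReal.ofReal_natCast]
    simp
  rw [e] at h
  exact (ENNReal.mul_le_mul_iff_right (by simp) (ENNReal.natCast_ne_top _)).1 h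

end InfoConstrainedOpt

theorem theoremt (d T : ℕ) (hd : 1 ≤ d) (hT : (d : ℝ) / 4 ≤ (T : ℝ)) (D B : ℝ) (hD : 0 < D)
    (hB : 0 < B) :
    ENNReal.ofReal (1 / 72 * (√(d : ℝ) * D * B) / √(T : ℝ)) ≤
        ⨆ X ∈ domains d D, minmaxError X (convexLipschitzClass X B) T (obliviousChannels d) ∧
      ∀ X ∈ domains d D, ∀ x₁ ∈ X,
        ∃ (π : Algorithm X T) (S : ChannelStrategy (obliviousChannels d)),
          IsUniformRCD x₁ (D * √(d : ℝ) / (B * √(T : ℝ))) π S ∧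
            ∀ fO ∈ convexLipschitzClass X B,
              optError fO.1 fO.2 π S ≤ ENNReal.ofReal (√(d : ℝ) * D * B / √(T : ℝ)) := by
  have hd' : (0 : ℝ) < d := Nat.cast_pos.2 hd
  have hT' : (0 : ℝ) < T := by linarith
  have hT0 : 0 < T := Nat.cast_pos.1 hT'
  have hsd : 0 < √(d : ℝ) := Real.sqrt_pos.2 hd'
  have hsT : 0 < √(T : ℝ) := Real.sqrt_pos.2 hT'
  have hsd2 : √(d : ℝ) ^ 2 = d := Real.sq_sqrt hd'.le
  have hsT2 : √(T : ℝ) ^ 2 = T := Real.sq_sqrt hT'.le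
  refine ⟨?_, fun X hX x₁ hx₁ => ?_⟩
  · have hcube := cube_mem_domains hD.le hd
    -- This `ε` gives `ε² T = d / 16` exactly, and this `c` gives the oracle outputs norm exactly
    -- `B`. The resulting constant is `1/4 · 1/2 · 5/8 = 5/64 ≥ 1/72`.
    refine le_iSup₂_of_le _ hcube (le_trans ?_ (minmaxError_cube_ge
      (ε := 1 / 4 * (√(d : ℝ) / √(T : ℝ))) (c := B / √(d : ℝ)) (by positivity) ?_ (by positivity)
      (by positivity) ?_ ?_ hcube.2.2.1))
    · refine ENNReal.ofReal_le_ofReal ?_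
      have e : 1 / 4 * (√(d : ℝ) / √(T : ℝ)) * (B / √(d : ℝ)) * (D / (2 * √(d : ℝ))) * (5 / 8 * d)
          = 5 / 64 * (√(d : ℝ) * D * B / √(T : ℝ)) := by
        nth_rewrite 4 [← hsd2]
        field_simp
        ring
      rw [e, mul_div_assoc]
      exact mul_le_mul_of_nonneg_right (by norm_num) (by positivity)
    · have h2 : √(d : ℝ) / √(T : ℝ) ≤ 2 := by
        rw [div_le_iff₀ hsT]
        refine Real.sqrt_le_iff.2 ⟨by positivity, ?_⟩
        rw [mul_pow, hsT2]
        linarith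
      linarith
    · rw [div_pow, hsd2]
      field_simp
    · rw [mul_pow, div_pow (√(d : ℝ)), hsd2, hsT2]
      refine le_of_eq ?_
      field_simp
      norm_num
  · obtain ⟨π, S, hR⟩ := exists_isUniformRCD hX hx₁ hd hT0 (D * √(d : ℝ) / (B * √(T : ℝ)))
    refine ⟨π, S, hR, fun fO hfO => ?_⟩
    refine (hR.optError_le hX hx₁ hd hT0 hB.le (by positivity) hfO).trans_eq ?_
    congr 1
    -- With `a = √d` and `b = √T`: the chosen step size balances the two terms of the bound, both
    -- being `D²`.
    have e : ∀ a b : ℝ, 0 < a → 0 < b → a ^ 2 / (2 * (D * a / (B * b)) * b ^ 2) *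
        (D ^ 2 + b ^ 2 * ((D * a / (B * b)) ^ 2 * B ^ 2 / a ^ 2)) = a * D * B / b := by
      intro a b ha hb
      field_simp
      ring
    simpa only [hsd2, hsT2] using e _ _ hsd hsT
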